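/- Let $k\ge 2$ be an integer, let $\lambda>0$ be real, and let $\mathfrak d:\mathbb Z_{>0}\to\mathbb Z_{\ge 0}$ satisfy $\mathfrak d(n)>0$ for infinitely many $n$. Put $T_0=0$ and $T_n=\sum_{i=1}^n\mathfrak d(i)$. For $n\ge 1$ let $\mathcal T_n$ be the complete $k$-ary tree of height $n$ with root $r$ (every vertex of height less than $n$ has exactly $k$ children, and the leaves are the vertices of height $n$), where $\mathcal T_n$ consists of the vertices of height at most $n$ of $\mathcal T_{n+1}$. Let $P_n$ be the transition matrix on the vertices of $\mathcal T_n$ given by \[ P_n(u,v)=\begin{cases} \frac1k & \text{if } u=r \text{ and } v \text{ is a child of } u,\\ \frac1{\lambda+k} & \text{if } u\ne r \text{ and } v \text{ is a child of } u,\\ \frac{\lambda}{\lambda+k} & \text{if } u \text{ is not a leaf and } v \text{ is the parent of } u,\\ 1 & \text{if } u \text{ is a leaf and } v \text{ is the parent of } u,\\ 0 & \text{otherwise.} \end{cases} \] Let $X_0=r,X_1,X_2,\dots$ be the (time-inhomogeneous) Markov chain whose transition from $X_t$ to $X_{t+1}$ follows $P_n$ whenever $T_{n-1}\le t<T_n$,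 and let $R(t)=\Pr[X_t=r]$. If \[ \sum_{n=1}^\infty \mathfrak d(n)\left(\frac{\lambda}{k}\right)^n=\infty , \] then $r$ is recurrent, that is, $\sum_{t=1}^\infty R(t)=\infty$. Otherwise $r$ is transient, that is, $\sum_{t=0}^\infty R(t)<\infty$. -/

import Mathlib

open MeasureTheory

/-- A random walk on a growing graph `(𝔡, G, P)`, with all graphs living inside one ambient vertex
type `V`. Phases are numbered `n = 1, 2, …`; the values of `dur`, `G`, `P` at `0` play no role. -/
structure RWoGG (V : Type*) where
  /-- the duration `𝔡(n)` of phase `n` (possibly zero) -/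
  dur : ℕ → ℕ
  /-- the simple graph `G(n) = (V(n), E(n))` of phase `n` -/
  G : ℕ → (⊤ : SimpleGraph V).Subgraph
  /-- the transition probabilities `P(n)` of phase `n`; only rows indexed by `V(n)` are used -/
  P : ℕ → V → V → ℝ
  finite_verts : ∀ n, 1 ≤ n → (G n).verts.Finite
  growing : ∀ n, 1 ≤ n → G n ≤ G (n + 1)
  P_nonneg : ∀ n, 1 ≤ n → ∀ u ∈ (G n).verts, ∀ v, 0 ≤ P n u v
  P_row : ∀ n, 1 ≤ n → ∀ u ∈ (G n).verts, HasSum (P n u) 1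
  P_support : ∀ n, 1 ≤ n → ∀ u ∈ (G n).verts, ∀ v, P n u v ≠ 0 → u = v ∨ (G n).Adj u v

namespace RWoGG

/-- `T_n = 𝔡(1) + ⋯ + 𝔡(n)`, the end of phase `n`; `T_0 = 0`. -/
def T {V : Type*} (D : RWoGG V) (n : ℕ) : ℕ := ∑ i ∈ Finset.Icc 1 n, D.dur i

/-- The process `X_0, X_1, X_2, …` on the probability space `(Ω, μ)` is a random walk on the growing
graph `D` started at `v`: it is Markovian, and the transition from `X_t` to `X_{t+1}` follows `P(n)`
whenever `T_{n-1} ≤ t < T_n`. -/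
structure IsWalk {V : Type*} (D : RWoGG V) (v : V) {Ω : Type*} [MeasurableSpace Ω]
    (μ : Measure Ω) (X : ℕ → Ω → V) : Prop where
  measurable : ∀ t u, MeasurableSet {ω | X t ω = u}
  start_mem : v ∈ (D.G 1).verts
  start : ∀ᵐ ω ∂μ, X 0 ω = v
  step : ∀ n, 1 ≤ n → ∀ t, D.T (n - 1) ≤ t → t < D.T n → ∀ x : ℕ → V,
    μ {ω | ∀ s ≤ t + 1, X s ω = x s} =
      μ {ω | ∀ s ≤ t, X s ω = x s} * ENNReal.ofReal (D.P n (x t) (x (t + 1)))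

end RWoGG

/-- The return probability `R(t) = Pr[X_t = v]`. -/
def returnProb {V Ω : Type*} [MeasurableSpace Ω] (μ : Measure Ω) (X : ℕ → Ω → V) (v : V)
    (t : ℕ) : ENNReal := μ {ω | X t ω = v}

/-- `v` is recurrent: `∑_{t ≥ 1} R(t) = ∞`. -/
def IsRecurrent {V Ω : Type*} [MeasurableSpace Ω] (μ : Measure Ω) (X : ℕ → Ω → V) (v : V) : Prop :=
  ∑' t : ℕ, returnProb μ X v (t + 1) = ⊤

/-- `v` is transient: `∑_{t ≥ 0} R(t) < ∞`. -/
def IsTransient {V Ω : Type*} [MeasurableSpace Ω] (μ : Measure Ω) (X : ℕ → Ω → V) (v : V) : Prop :=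
  ∑' t : ℕ, returnProb μ X v t < ⊤

namespace KaryTree

/-- Vertices of the trees are words over `k` letters: the root is the empty word, the height of a
vertex is its length, and the children of `u` are the words `a :: u`. -/
def IsChild {k : ℕ} (u v : List (Fin k)) : Prop := ∃ a : Fin k, v = a :: u

theorem IsChild.length {k : ℕ} {u v : List (Fin k)} (h : IsChild u v) :
    v.length = u.length + 1 := by
  obtain ⟨a, rfl⟩ := h
  simp

/-- The complete `k`-ary tree of height `n`. -/
def tree (k n : ℕ) : (⊤ : SimpleGraph (List (Fin k))).Subgraph where
  verts := {v | v.length ≤ n}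
  Adj u v := (u.length ≤ n ∧ v.length ≤ n) ∧ (IsChild u v ∨ IsChild v u)
  adj_sub := by
    rintro u v ⟨-, h⟩
    rw [SimpleGraph.top_adj]
    rintro rfl
    rcases h with h | h <;> · have := h.length; omega
  edge_vert h := h.1.1
  symm := ⟨fun _ _ h => ⟨h.1.symm, h.2.symm⟩⟩

open Classical in
/-- The transition probabilities of the `λ`-biased walk on the complete `k`-ary tree of height `n`;
the leaves are the vertices of height `n`. -/
noncomputable def trans (k : ℕ) (lam : ℝ) (n : ℕ) (u v : List (Fin k)) : ℝ :=
  if u.length ≤ n ∧ v.length ≤ n then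
    if IsChild u v then
      if u = [] then 1 / (k : ℝ) else 1 / (lam + k)
    else if IsChild v u then
      if u.length = n then 1 else lam / (lam + k)
    else 0
  else 0

theorem trans_nonneg (k : ℕ) (lam : ℝ) (hlam : 0 < lam) (n : ℕ) (u v : List (Fin k)) :
    0 ≤ trans k lam n u v := by
  unfold trans
  split_ifs <;> positivity

theorem trans_support (k : ℕ) (lam : ℝ) (n : ℕ) (u v : List (Fin k))
    (h : trans k lam n u v ≠ 0) : (tree k n).Adj u v := by
  unfold trans at h
  split_ifs at h with h1 h2 h3 h4 h5
  · exact ⟨h1, Or.inl h2⟩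
  · exact ⟨h1, Or.inl h2⟩
  · exact ⟨h1, Or.inr h4⟩
  · exact ⟨h1, Or.inr h4⟩
  · exact absurd rfl h
  · exact absurd rfl h

theorem trans_row (k : ℕ) (hk : 2 ≤ k) (lam : ℝ) (hlam : 0 < lam) (n : ℕ) (hn : 1 ≤ n)
    (u : List (Fin k)) (hu : u.length ≤ n) : HasSum (trans k lam n u) 1 := by
  classical
  have hk0 : (0 : ℝ) < k := by exact_mod_cast (by omega : 0 < k)
  have hinj : Function.Injective (fun a : Fin k => a :: u) := fun a b h => by simpa using h
  let C : Finset (List (Fin k)) := Finset.univ.image (fun a : Fin k => a :: u)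
  have hC : ∀ v, v ∈ C ↔ IsChild u v := by
    intro v
    simp [C, IsChild, eq_comm]
  have hsumC : ∑ v ∈ C, trans k lam n u v = ∑ a : Fin k, trans k lam n u (a :: u) :=
    Finset.sum_image (fun a _ b _ h => hinj h)
  rcases u with _ | ⟨b, w⟩
  · have key : ∑ v ∈ C, trans k lam n [] v = 1 := by
      rw [hsumC]
      have : ∀ a : Fin k, trans k lam n [] (a :: []) = 1 / (k : ℝ) := by
        intro a
        simp [trans, IsChild, hn]
      simp only [this, Finset.sum_const, Finset.card_univ, Fintype.card_fin, nsmul_eq_mul]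
      field_simp
    rw [← key]
    refine hasSum_sum_of_ne_finset_zero ?_
    intro v hv
    by_contra h
    rcases (trans_support k lam n [] v h).2 with h1 | ⟨a, h1⟩
    · exact hv ((hC v).2 h1)
    · simp at h1
  · have hw : w ∉ C := by
      intro h
      have := ((hC w).1 h).length
      simp at this
      omega
    have hnot : ¬ IsChild (b :: w) w := fun h => hw ((hC w).2 h)
    have hpar : IsChild w (b :: w) := ⟨b, rfl⟩
    have hlen : w.length + 1 ≤ n := by simpa using hu
    have key : ∑ v ∈ insert w C, trans k lam n (b :: w) v = 1 := by
      rw [Finset.sum_insert hw, hsumC]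
      by_cases hleaf : w.length + 1 = n
      · have h1 : trans k lam n (b :: w) w = 1 := by
          unfold trans
          rw [if_pos ⟨hu, by omega⟩, if_neg hnot, if_pos hpar, if_pos (by simpa using hleaf)]
        have h2 : ∀ a : Fin k, trans k lam n (b :: w) (a :: b :: w) = 0 := by
          intro a
          unfold trans
          rw [if_neg]
          simp only [List.length_cons]
          omega
        simp [h1, h2]
      · have h1 : trans k lam n (b :: w) w = lam / (lam + k) := by
          unfold trans
          rw [if_pos ⟨hu, by omega⟩, if_neg hnot, if_pos hpar, if_neg (by simpa using hleaf)]
        have h2 : ∀ a : Fin k, trans k lam n (b :: w) (a :: b :: w) = 1 / (lam + k) := by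
          intro a
          unfold trans
          rw [if_pos ⟨hu, by simp only [List.length_cons]; omega⟩, if_pos ⟨a, rfl⟩,
            if_neg (by simp)]
        simp only [h1, h2, Finset.sum_const, Finset.card_univ, Fintype.card_fin, nsmul_eq_mul]
        field_simp
    rw [← key]
    refine hasSum_sum_of_ne_finset_zero ?_
    intro v hv
    by_contra h
    rw [Finset.mem_insert, not_or] at hv
    rcases (trans_support k lam n (b :: w) v h).2 with h1 | ⟨a, h1⟩
    · exact hv.2 ((hC v).2 h1)
    · exact hv.1 (List.cons.inj h1).2.symm

/-- The random walk `(𝔡, G, P)` on the growing complete `k`-ary tree: phase `n` lasts `𝔡(n)` steps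
on the tree of height `n`, with the `λ`-biased transition probabilities. -/
noncomputable def walk (k : ℕ) (hk : 2 ≤ k) (lam : ℝ) (hlam : 0 < lam) (dur : ℕ → ℕ) :
    RWoGG (List (Fin k)) where
  dur := dur
  G := tree k
  P := trans k lam
  finite_verts n _ := List.finite_length_le (Fin k) n
  growing _ _ := ⟨fun _ h => Nat.le_succ_of_le h,
    fun _ _ h => ⟨⟨Nat.le_succ_of_le h.1.1, Nat.le_succ_of_le h.1.2⟩, h.2⟩⟩
  P_nonneg n _ u _ v := trans_nonneg k lam hlam n u v
  P_row n hn u hu := trans_row k hk lam hlam n hn u hu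
  P_support n _ u _ v h := Or.inr (trans_support k lam n u v h)

end KaryTree

/-! All children of a vertex are equally likely, so the height of the walk is itself a chain on `0,
…, n`: up with probability `p = k/(λ+k)`, down with `q = λ/(λ+k)`, reflected at both ends. Put `β =
λ/k = q/p`. No mixing estimate is needed: each direction is a Foster–Lyapunov argument with a
function `F n j` of phase and height that does not increase with the phase, so that tree growth can
only help. `heightExp_add_sum_le` turns a one-step drift bound into a bound on sums over time, and
`tsum_phase` rewrites `∑ₜ β ^ phase(t)` as `∑ₙ 𝔡(n) βⁿ`.

If `β < 1`, the function `βʲ` is harmonic at inner heights, loses `1 - β` at the root and gains a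
multiple of `βⁿ` at a leaf; hence `∑ R(t)` is bounded by a constant plus a multiple of the series.
Conversely, `heightOp_lyapunov_le` gives a function with drift at most `-(p - q) βⁿ` away from the
root, so the series is bounded by a constant plus a multiple of `∑ R(t)`.

If `β ≥ 1`, the series always diverges and the root must be recurrent. Were `∑ R(t)` finite, the
mean height would stay bounded, which keeps `E[2 ^ (-height)]` away from `0`; but a further drift
bound makes these expectations summable. -/

open scoped ENNReal

/-! ### One-step evolution of the marginals. -/

namespace RWoGG

variable {V Ω : Type*} [MeasurableSpace Ω]

/-- The events fixing the first `m` positions of a process partition the probability space. -/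
theorem measure_eq_tsum_cylinder [Countable V] {μ : Measure Ω} {X : ℕ → Ω → V}
    (hX : ∀ t u, MeasurableSet {ω | X t ω = u}) (m : ℕ) {B : Set Ω} (hB : MeasurableSet B) :
    μ B = ∑' x : Fin m → V, μ ({ω | ∀ i : Fin m, X i ω = x i} ∩ B) := by
  rw [← measure_iUnion]
  · congr 1
    ext ω
    simp only [Set.mem_iUnion, Set.mem_inter_iff, Set.mem_ofPred_eq]
    exact ⟨fun h => ⟨fun i => X i ω, fun _ => rfl, h⟩, fun ⟨_, _, h⟩ => h⟩
  · intro x y hxy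
    refine Set.disjoint_left.2 ?_
    rintro ω ⟨hx, -⟩ ⟨hy, -⟩
    exact hxy (funext fun i => (hx i).symm.trans (hy i))
  · intro x
    refine MeasurableSet.inter ?_ hB
    rw [Set.ofPred_forall]
    exact MeasurableSet.iInter fun i => hX _ _

/-- The one-time marginals of a random walk on a growing graph evolve by the transition matrix of
the current phase. -/
theorem IsWalk.returnProb_succ [Countable V] {D : RWoGG V} {v₀ : V} {μ : Measure Ω}
    {X : ℕ → Ω → V} (hX : D.IsWalk v₀ μ X) {n t : ℕ} (hn : 1 ≤ n) (h1 : D.T (n - 1) ≤ t)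
    (h2 : t < D.T n) (v : V) :
    returnProb μ X v (t + 1) = ∑' u, returnProb μ X u t * ENNReal.ofReal (D.P n u v) := by
  unfold returnProb
  have hL : ∀ x : Fin (t + 1) → V,
      μ ({ω | ∀ i : Fin (t + 1), X i ω = x i} ∩ {ω | X (t + 1) ω = v}) =
        μ {ω | ∀ i : Fin (t + 1), X i ω = x i} *
          ENNReal.ofReal (D.P n (x (Fin.last t)) v) := by
    intro x
    -- The path `x` is prolonged by the value `v` at time `t + 1`.
    have key := hX.step n hn t h1 h2 (fun s => if h : s < t + 1 then x ⟨s, h⟩ else v)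
    have e1 : {ω | ∀ s ≤ t + 1, X s ω = if h : s < t + 1 then x ⟨s, h⟩ else v} =
        {ω | ∀ i : Fin (t + 1), X i ω = x i} ∩ {ω | X (t + 1) ω = v} := by
      ext ω
      simp only [Set.mem_ofPred_eq, Set.mem_inter_iff]
      constructor
      · intro h
        refine ⟨fun i => ?_, ?_⟩
        · have := h i (by omega)
          rwa [dif_pos i.isLt] at this
        · simpa using h (t + 1) le_rfl
      · rintro ⟨h, h'⟩ s hs
        split_ifs with hlt
        · exact h ⟨s, hlt⟩
        · obtain rfl : s = t + 1 := by omega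
          exact h'
    have e2 : {ω | ∀ s ≤ t, X s ω = if h : s < t + 1 then x ⟨s, h⟩ else v} =
        {ω | ∀ i : Fin (t + 1), X i ω = x i} := by
      ext ω
      simp only [Set.mem_ofPred_eq]
      constructor
      · intro h i
        have := h i (by omega)
        rwa [dif_pos i.isLt] at this
      · intro h s hs
        rw [dif_pos (by omega)]
        exact h ⟨s, by omega⟩
    rw [e1, e2] at key
    simpa [Fin.last] using key
  have hR : ∀ x : Fin (t + 1) → V,
      ∑' u, μ ({ω | ∀ i : Fin (t + 1), X i ω = x i} ∩ {ω | X t ω = u}) *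
          ENNReal.ofReal (D.P n u v) =
        μ {ω | ∀ i : Fin (t + 1), X i ω = x i} *
          ENNReal.ofReal (D.P n (x (Fin.last t)) v) := by
    intro x
    rw [tsum_eq_single (x (Fin.last t))]
    · congr 2
      ext ω
      simp only [Set.mem_inter_iff, Set.mem_ofPred_eq, and_iff_left_iff_imp]
      intro h
      exact h (Fin.last t)
    · intro u hu
      have : {ω | ∀ i : Fin (t + 1), X i ω = x i} ∩ {ω | X t ω = u} = ∅ := by
        refine Set.eq_empty_of_forall_notMem ?_
        rintro ω ⟨h, h'⟩
        exact hu (h'.symm.trans (h (Fin.last t)))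
      rw [this, measure_empty, zero_mul]
  rw [measure_eq_tsum_cylinder hX.measurable (t + 1) (hX.measurable (t + 1) v)]
  simp_rw [hL, ← hR]
  rw [ENNReal.tsum_comm]
  refine tsum_congr fun u => ?_
  rw [ENNReal.tsum_mul_right,
    ← measure_eq_tsum_cylinder hX.measurable (t + 1) (hX.measurable t u)]

/-! ### The clock: phases as a function of time. -/

theorem T_succ (D : RWoGG V) (n : ℕ) : D.T (n + 1) = D.T n + D.dur (n + 1) :=
  Finset.sum_Icc_succ_top (by omega) _

theorem T_mono (D : RWoGG V) : Monotone D.T :=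
  monotone_nat_of_le_succ fun n => by rw [T_succ]; omega

theorem exists_lt_T (D : RWoGG V) (h : ∀ N : ℕ, ∃ n, N ≤ n ∧ 0 < D.dur n) (t : ℕ) :
    ∃ n, t < D.T n := by
  induction t with
  | zero =>
    obtain ⟨n, hn, hd⟩ := h 1
    obtain ⟨m, rfl⟩ : ∃ m, n = m + 1 := ⟨n - 1, by omega⟩
    exact ⟨m + 1, by rw [T_succ]; omega⟩
  | succ t ih =>
    obtain ⟨N, hN⟩ := ih
    obtain ⟨n, hn, hd⟩ := h (N + 1)
    obtain ⟨m, rfl⟩ : ∃ m, n = m + 1 := ⟨n - 1, by omega⟩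
    have := D.T_mono (show N ≤ m by omega)
    exact ⟨m + 1, by rw [T_succ]; omega⟩

/-- The phase of a growing graph whose phases cover all times that contains the time `t`. -/
def phase (D : RWoGG V) (h : ∀ t, ∃ n, t < D.T n) (t : ℕ) : ℕ := Nat.find (h t)

section phase

variable (D : RWoGG V) (h : ∀ t, ∃ n, t < D.T n)

theorem lt_T_phase (t : ℕ) : t < D.T (D.phase h t) := Nat.find_spec (h t)

theorem phase_pos (t : ℕ) : 1 ≤ D.phase h t := by
  by_contra! h0
  have := D.lt_T_phase h t
  rw [Nat.lt_one_iff.1 h0] at this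
  simp [T] at this

theorem T_pred_phase_le (t : ℕ) : D.T (D.phase h t - 1) ≤ t := by
  have := D.phase_pos h t
  exact not_lt.1 (Nat.find_min (h t) (show D.phase h t - 1 < D.phase h t by omega))

theorem phase_le_succ (t : ℕ) : D.phase h t ≤ D.phase h (t + 1) :=
  Nat.find_min' _ ((Nat.lt_succ_self t).trans (D.lt_T_phase h (t + 1)))

theorem phase_eq {n t : ℕ} (h1 : D.T n ≤ t) (h2 : t < D.T (n + 1)) : D.phase h t = n + 1 := by
  refine le_antisymm (Nat.find_min' _ h2) ?_
  by_contra! hlt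
  have := D.T_mono (Nat.lt_succ_iff.1 hlt)
  have := D.lt_T_phase h t
  omega

theorem sum_range_T_phase (w : ℕ → ℝ≥0∞) (N : ℕ) :
    ∑ t ∈ Finset.range (D.T N), w (D.phase h t) =
      ∑ n ∈ Finset.range N, D.dur (n + 1) * w (n + 1) := by
  induction N with
  | zero => simp [T]
  | succ N ih =>
    rw [Finset.sum_range_succ, ← ih, T_succ, Finset.sum_range_add]
    congr 1
    rw [Finset.sum_congr rfl (g := fun _ => w (N + 1))]
    · simp
    · intro x hx
      have := Finset.mem_range.1 hx
      rw [D.phase_eq h (Nat.le_add_right _ _) (by rw [T_succ]; omega)]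

/-- Summing a function of the phase over all times weights each phase by its duration. -/
theorem tsum_phase (w : ℕ → ℝ≥0∞) :
    ∑' t, w (D.phase h t) = ∑' n, (D.dur (n + 1) : ℝ≥0∞) * w (n + 1) := by
  have hT : Filter.Tendsto D.T Filter.atTop Filter.atTop :=
    Filter.tendsto_atTop_atTop_of_monotone D.T_mono fun t => (h t).imp fun _ => le_of_lt
  have h1 := (ENNReal.tendsto_nat_tsum fun t => w (D.phase h t)).comp hT
  have h2 := ENNReal.tendsto_nat_tsum fun n => (D.dur (n + 1) : ℝ≥0∞) * w (n + 1)
  refine tendsto_nhds_unique h1 (h2.congr fun N => ?_)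
  exact (D.sum_range_T_phase h w N).symm

end phase

end RWoGG

/-! ### Projection of the walk to its height. -/

namespace KaryTree

/-- The transition operator of the height of the biased walk on a tree of height `n`, with
probability `p` of moving up and `q` of moving down at an inner vertex. -/
def heightOp (p q : ℝ) (n : ℕ) (f : ℕ → ℝ) (j : ℕ) : ℝ :=
  if j = 0 then f 1 else if j = n then f (n - 1) else p * f (j + 1) + q * f (j - 1)

/-- Lumpability: the row of `u`, tested against a function of the height, depends on `u` only
through its height, because the `k` children carry equal weight. -/
theorem hasSum_trans_mul {k : ℕ} (hk : 2 ≤ k) {lam : ℝ} {n : ℕ} (hn : 1 ≤ n) {u : List (Fin k)}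
    (hu : u.length ≤ n) (f : ℕ → ℝ) :
    HasSum (fun v => trans k lam n u v * f v.length)
      (heightOp (k / (lam + k)) (lam / (lam + k)) n f u.length) := by
  classical
  have hk0 : (k : ℝ) ≠ 0 := by exact_mod_cast (by omega : k ≠ 0)
  have hinj : Function.Injective (fun a : Fin k => a :: u) := fun a b h => by simpa using h
  let C : Finset (List (Fin k)) := Finset.univ.image (fun a : Fin k => a :: u)
  have hC : ∀ v, v ∈ C ↔ IsChild u v := by
    intro v
    simp [C, IsChild, eq_comm]
  have hsumC : ∑ v ∈ C, trans k lam n u v * f v.length =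
      ∑ a : Fin k, trans k lam n u (a :: u) * f (u.length + 1) :=
    Finset.sum_image (fun a _ b _ h => hinj h)
  rcases u with _ | ⟨b, w⟩
  · have key : ∑ v ∈ C, trans k lam n [] v * f v.length = f 1 := by
      have : ∀ a : Fin k, trans k lam n [] (a :: []) = 1 / (k : ℝ) := by
        intro a
        simp [trans, IsChild, hn]
      rw [hsumC]
      simp only [this, Finset.sum_const, Finset.card_univ, Fintype.card_fin, nsmul_eq_mul]
      field_simp
      simp
    rw [show heightOp (k / (lam + k)) (lam / (lam + k)) n f ([] : List (Fin k)).length = f 1 by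
      simp [heightOp], ← key]
    refine hasSum_sum_of_ne_finset_zero ?_
    intro v hv
    by_contra h
    rcases (trans_support k lam n [] v (left_ne_zero_of_mul h)).2 with h1 | ⟨a, h1⟩
    · exact hv ((hC v).2 h1)
    · simp at h1
  · have hw : w ∉ C := by
      intro h
      have := ((hC w).1 h).length
      simp at this
      omega
    have hnot : ¬ IsChild (b :: w) w := fun h => hw ((hC w).2 h)
    have hpar : IsChild w (b :: w) := ⟨b, rfl⟩
    have hlen : w.length + 1 ≤ n := by simpa using hu
    have key : ∑ v ∈ insert w C, trans k lam n (b :: w) v * f v.length =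
        heightOp (k / (lam + k)) (lam / (lam + k)) n f (b :: w).length := by
      rw [Finset.sum_insert hw, hsumC]
      by_cases hleaf : w.length + 1 = n
      · have h1 : trans k lam n (b :: w) w = 1 := by
          unfold trans
          rw [if_pos ⟨hu, by omega⟩, if_neg hnot, if_pos hpar, if_pos (by simpa using hleaf)]
        have h2 : ∀ a : Fin k, trans k lam n (b :: w) (a :: b :: w) = 0 := by
          intro a
          unfold trans
          rw [if_neg]
          simp only [List.length_cons]
          omega
        simp only [h1, h2]
        simp [heightOp, ← hleaf]
      · have h1 : trans k lam n (b :: w) w = lam / (lam + k) := by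
          unfold trans
          rw [if_pos ⟨hu, by omega⟩, if_neg hnot, if_pos hpar, if_neg (by simpa using hleaf)]
        have h2 : ∀ a : Fin k, trans k lam n (b :: w) (a :: b :: w) = 1 / (lam + k) := by
          intro a
          unfold trans
          rw [if_pos ⟨hu, by simp only [List.length_cons]; omega⟩, if_pos ⟨a, rfl⟩,
            if_neg (by simp)]
        simp only [h1, h2, Finset.sum_const, Finset.card_univ, Fintype.card_fin, nsmul_eq_mul,
          heightOp, List.length_cons, hleaf, if_false, Nat.succ_ne_zero, Nat.add_sub_cancel]
        ring
    rw [← key]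
    refine hasSum_sum_of_ne_finset_zero ?_
    intro v hv
    by_contra h
    rw [Finset.mem_insert, not_or] at hv
    rcases (trans_support k lam n (b :: w) v (left_ne_zero_of_mul h)).2 with h1 | ⟨a, h1⟩
    · exact hv.2 ((hC v).2 h1)
    · exact hv.1 (List.cons.inj h1).2.symm

theorem trans_eq_zero_of_lt {k : ℕ} {lam : ℝ} {n : ℕ} {u v : List (Fin k)} (h : n < v.length) :
    trans k lam n u v = 0 := by
  unfold trans
  rw [if_neg fun h' => absurd h'.2 (not_le.2 h)]

theorem tsum_trans_mul {k : ℕ} (hk : 2 ≤ k) {lam : ℝ} (hlam : 0 < lam) {n : ℕ} (hn : 1 ≤ n)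
    {u : List (Fin k)} (hu : u.length ≤ n) {f : ℕ → ℝ} (hf : ∀ j ≤ n, 0 ≤ f j) :
    ∑' v : List (Fin k), ENNReal.ofReal (trans k lam n u v) * ENNReal.ofReal (f v.length) =
      ENNReal.ofReal (heightOp (k / (lam + k)) (lam / (lam + k)) n f u.length) := by
  have hs := hasSum_trans_mul hk (lam := lam) hn hu f
  rw [← hs.tsum_eq, ENNReal.ofReal_tsum_of_nonneg _ hs.summable]
  · exact tsum_congr fun v => (ENNReal.ofReal_mul (trans_nonneg k lam hlam n u v)).symm
  · intro v
    by_cases hv : v.length ≤ n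
    · exact mul_nonneg (trans_nonneg k lam hlam n u v) (hf _ hv)
    · rw [trans_eq_zero_of_lt (not_le.1 hv), zero_mul]

/-! ### Expectations of functions of the height, and the drift method. -/

section expectation

variable {k : ℕ} {Ω : Type*} [MeasurableSpace Ω]

/-- The expectation of the nonnegative part of `f` at the height of the process at time `t`. -/
noncomputable def heightExp (μ : Measure Ω) (X : ℕ → Ω → List (Fin k)) (t : ℕ) (f : ℕ → ℝ) :
    ℝ≥0∞ :=
  ∑' u : List (Fin k), returnProb μ X u t * ENNReal.ofReal (f u.length)

variable {μ : Measure Ω} {X : ℕ → Ω → List (Fin k)}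

theorem heightExp_root (t : ℕ) {b : ℝ} :
    heightExp μ X t (fun j => if j = 0 then b else 0) =
      returnProb μ X [] t * ENNReal.ofReal b := by
  unfold heightExp
  rw [tsum_eq_single []]
  · simp
  · intro u hu
    simp [hu]

theorem heightExp_add (t : ℕ) {f g : ℕ → ℝ} (hf : ∀ j, 0 ≤ f j) (hg : ∀ j, 0 ≤ g j) :
    heightExp μ X t (fun j => f j + g j) = heightExp μ X t f + heightExp μ X t g := by
  unfold heightExp
  rw [← ENNReal.tsum_add]
  refine tsum_congr fun u => ?_
  rw [ENNReal.ofReal_add (hf _) (hg _), mul_add]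

theorem heightExp_const_mul (t : ℕ) {c : ℝ} (hc : 0 ≤ c) (f : ℕ → ℝ) :
    heightExp μ X t (fun j => c * f j) = ENNReal.ofReal c * heightExp μ X t f := by
  unfold heightExp
  rw [← ENNReal.tsum_mul_left]
  refine tsum_congr fun u => ?_
  rw [ENNReal.ofReal_mul hc, mul_left_comm]

theorem heightExp_const [IsProbabilityMeasure μ] (hX : ∀ t u, MeasurableSet {ω | X t ω = u})
    (t : ℕ) (c : ℝ) : heightExp μ X t (fun _ => c) = ENNReal.ofReal c := by
  have h1 : ∑' u, returnProb μ X u t = 1 := by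
    unfold returnProb
    rw [← measure_iUnion, ← measure_univ (μ := μ)]
    · congr 1
      ext ω
      simp
    · intro u v huv
      exact Set.disjoint_left.2 fun ω h h' => huv (h.symm.trans h')
    · exact hX t
  unfold heightExp
  rw [ENNReal.tsum_mul_right, h1, one_mul]

theorem heightExp_mono (t : ℕ) {f g : ℕ → ℝ} (h : ∀ j, f j ≤ g j) :
    heightExp μ X t f ≤ heightExp μ X t g :=
  ENNReal.tsum_le_tsum fun u => by gcongr; exact h _

variable {hk : 2 ≤ k} {lam : ℝ} {hlam : 0 < lam} {dur : ℕ → ℕ}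

theorem heightExp_zero [IsProbabilityMeasure μ]
    (hX : (walk k hk lam hlam dur).IsWalk [] μ X) (f : ℕ → ℝ) :
    heightExp μ X 0 f = ENNReal.ofReal (f 0) := by
  unfold heightExp
  rw [tsum_eq_single []]
  · have : returnProb μ X [] 0 = 1 := by
      unfold returnProb
      rw [← measure_univ (μ := μ)]
      refine measure_congr ?_
      filter_upwards [hX.start] with ω hω
      exact eq_true hω
    rw [this, one_mul, List.length_nil]
  · intro u hu
    have : returnProb μ X u 0 = 0 := by
      unfold returnProb
      refine measure_mono_null (fun ω (hω : X 0 ω = u) => ?_) (ae_iff.1 hX.start)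
      exact fun h => hu (hω.symm.trans h)
    rw [this, zero_mul]

variable (h : ∀ t, ∃ n, t < (walk k hk lam hlam dur).T n)

/-- The walk never leaves the tree of the current phase. -/
theorem returnProb_eq_zero_of_phase_lt (hX : (walk k hk lam hlam dur).IsWalk [] μ X) (t : ℕ)
    {u : List (Fin k)} (hu : (walk k hk lam hlam dur).phase h t < u.length) :
    returnProb μ X u t = 0 := by
  cases t with
  | zero =>
    unfold returnProb
    refine measure_mono_null (fun ω (hω : X 0 ω = u) => ?_) (ae_iff.1 hX.start)
    rintro (h' : X 0 ω = [])
    rw [← hω, h'] at hu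
    simp at hu
  | succ t =>
    rw [hX.returnProb_succ (RWoGG.phase_pos _ h t) (RWoGG.T_pred_phase_le _ h t)
      (RWoGG.lt_T_phase _ h t), ENNReal.tsum_eq_zero]
    intro w
    have : (walk k hk lam hlam dur).P ((walk k hk lam hlam dur).phase h t) w u = 0 :=
      trans_eq_zero_of_lt ((RWoGG.phase_le_succ _ h t).trans_lt hu)
    rw [this, ENNReal.ofReal_zero, mul_zero]

/-- Since `ENNReal.ofReal` truncates, this needs `f` nonnegative at the heights the walk can reach;
larger heights carry no mass. -/
theorem heightExp_succ (hX : (walk k hk lam hlam dur).IsWalk [] μ X) (t : ℕ) {f : ℕ → ℝ}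
    (hf : ∀ j ≤ (walk k hk lam hlam dur).phase h t, 0 ≤ f j) :
    heightExp μ X (t + 1) f = heightExp μ X t (heightOp (k / (lam + k)) (lam / (lam + k))
      ((walk k hk lam hlam dur).phase h t) f) := by
  have hn := RWoGG.phase_pos _ h t
  unfold heightExp
  simp_rw [hX.returnProb_succ hn (RWoGG.T_pred_phase_le _ h t) (RWoGG.lt_T_phase _ h t),
    ← ENNReal.tsum_mul_right]
  rw [ENNReal.tsum_comm]
  refine tsum_congr fun u => ?_
  simp_rw [mul_assoc]
  rw [ENNReal.tsum_mul_left]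
  by_cases hu : u.length ≤ (walk k hk lam hlam dur).phase h t
  · rw [← tsum_trans_mul hk hlam hn hu hf]
    rfl
  · rw [returnProb_eq_zero_of_phase_lt h hX t (not_le.1 hu), zero_mul, zero_mul]

/-- **Foster–Lyapunov bound**: a function `F n j` of phase and height whose drift is at most
`b n j - w n j` and which decreases with the phase controls the expected sum of `w` by that
of `b`. -/
theorem heightExp_add_sum_le [IsProbabilityMeasure μ]
    (hX : (walk k hk lam hlam dur).IsWalk [] μ X) {F w b : ℕ → ℕ → ℝ}
    (hF : ∀ n j, j ≤ n → 0 ≤ F n j) (hF' : ∀ n j, 1 ≤ n → j ≤ n → F (n + 1) j ≤ F n j)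
    (hw : ∀ n j, 0 ≤ w n j) (hb : ∀ n j, 0 ≤ b n j)
    (hd : ∀ n j, 1 ≤ n → j ≤ n →
      heightOp (k / (lam + k)) (lam / (lam + k)) n (F n) j + w n j ≤ F n j + b n j) (N : ℕ) :
    heightExp μ X N (F ((walk k hk lam hlam dur).phase h N)) +
        ∑ t ∈ Finset.range N, heightExp μ X t (w ((walk k hk lam hlam dur).phase h t)) ≤
      ENNReal.ofReal (F 1 0) +
        ∑ t ∈ Finset.range N, heightExp μ X t (b ((walk k hk lam hlam dur).phase h t)) := by
  -- The phase may jump by more than one, also at time `0`, since phases of duration zero are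
  -- skipped.
  have hanti : ∀ m n j, 1 ≤ m → m ≤ n → j ≤ m → F n j ≤ F m j := by
    intro m n j hm hmn hj
    induction n, hmn using Nat.le_induction with
    | base => exact le_rfl
    | succ n hmn ih => exact (hF' n j (by omega) (by omega)).trans ih
  induction N with
  | zero =>
    rw [heightExp_zero hX]
    simp only [Finset.range_zero, Finset.sum_empty, add_zero]
    exact ENNReal.ofReal_le_ofReal (hanti _ _ _ le_rfl (RWoGG.phase_pos _ h 0) (by omega))
  | succ N ih =>
    set φ := (walk k hk lam hlam dur).phase h with hφ
    have hpos : 1 ≤ φ N := RWoGG.phase_pos _ h N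
    have hle : φ N ≤ φ (N + 1) := RWoGG.phase_le_succ _ h N
    have hop : ∀ j ≤ φ N, 0 ≤ heightOp (k / (lam + k)) (lam / (lam + k)) (φ N) (F (φ N)) j := by
      intro j hj
      unfold heightOp
      split_ifs with h1 h2
      · exact hF _ _ hpos
      · exact hF _ _ (by omega)
      · have := hF (φ N) (j + 1) (by omega)
        have := hF (φ N) (j - 1) (by omega)
        positivity
    have step : heightExp μ X (N + 1) (F (φ (N + 1))) + heightExp μ X N (w (φ N)) ≤
        heightExp μ X N (F (φ N)) + heightExp μ X N (b (φ N)) := by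
      have h1 : heightExp μ X (N + 1) (F (φ (N + 1))) ≤ heightExp μ X (N + 1) (F (φ N)) := by
        unfold heightExp
        refine ENNReal.tsum_le_tsum fun u => ?_
        by_cases hu : u.length ≤ φ N
        · gcongr
          exact hanti _ _ _ hpos hle hu
        -- The step into time `N + 1` still uses the tree of height `φ N`, so the walk lies there
        -- even if the phase has changed; this is the range in which `F` is known to decrease.
        · have : returnProb μ X u (N + 1) = 0 := by
            rw [hX.returnProb_succ hpos (RWoGG.T_pred_phase_le _ h N)
              (RWoGG.lt_T_phase _ h N), ENNReal.tsum_eq_zero]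
            intro v
            have : (walk k hk lam hlam dur).P (φ N) v u = 0 :=
              trans_eq_zero_of_lt (not_le.1 hu)
            rw [this, ENNReal.ofReal_zero, mul_zero]
          rw [this, zero_mul, zero_mul]
      refine (add_le_add_left h1 _).trans ?_
      rw [heightExp_succ h hX N (fun j hj => hF _ _ hj)]
      unfold heightExp
      rw [← ENNReal.tsum_add, ← ENNReal.tsum_add]
      refine ENNReal.tsum_le_tsum fun u => ?_
      by_cases hu : u.length ≤ φ N
      · rw [← mul_add, ← mul_add, ← ENNReal.ofReal_add (hop _ hu) (hw _ _),
          ← ENNReal.ofReal_add (hF _ _ hu) (hb _ _)]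
        exact mul_le_mul_right (ENNReal.ofReal_le_ofReal (hd _ _ hpos hu)) _
      · rw [returnProb_eq_zero_of_phase_lt h hX N (not_le.1 hu)]
        simp
    rw [Finset.sum_range_succ, Finset.sum_range_succ]
    calc _ = (heightExp μ X (N + 1) (F (φ (N + 1))) + heightExp μ X N (w (φ N))) +
          ∑ t ∈ Finset.range N, heightExp μ X t (w (φ t)) := by ring
      _ ≤ (heightExp μ X N (F (φ N)) + heightExp μ X N (b (φ N))) +
          ∑ t ∈ Finset.range N, heightExp μ X t (w (φ t)) := by gcongr
      _ = (heightExp μ X N (F (φ N)) + ∑ t ∈ Finset.range N, heightExp μ X t (w (φ t))) +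
          heightExp μ X N (b (φ N)) := by ring
      _ ≤ _ := by
        refine (add_le_add_left ih _).trans_eq ?_
        ring

theorem tsum_heightExp_le [IsProbabilityMeasure μ]
    (hX : (walk k hk lam hlam dur).IsWalk [] μ X) {F w b : ℕ → ℕ → ℝ}
    (hF : ∀ n j, j ≤ n → 0 ≤ F n j) (hF' : ∀ n j, 1 ≤ n → j ≤ n → F (n + 1) j ≤ F n j)
    (hw : ∀ n j, 0 ≤ w n j) (hb : ∀ n j, 0 ≤ b n j)
    (hd : ∀ n j, 1 ≤ n → j ≤ n →
      heightOp (k / (lam + k)) (lam / (lam + k)) n (F n) j + w n j ≤ F n j + b n j) :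
    ∑' t, heightExp μ X t (w ((walk k hk lam hlam dur).phase h t)) ≤
      ENNReal.ofReal (F 1 0) +
        ∑' t, heightExp μ X t (b ((walk k hk lam hlam dur).phase h t)) := by
  rw [ENNReal.tsum_eq_iSup_nat]
  refine iSup_le fun N => ?_
  refine le_add_self.trans ((heightExp_add_sum_le h hX hF hF' hw hb hd N).trans ?_)
  gcongr
  exact ENNReal.sum_le_tsum _

end expectation

end KaryTree

/-! ### Drift inequalities for the height chain. -/

namespace KaryTree

section drift

variable {p q β : ℝ}

/-- Harmonicity at inner heights is `p β² + q = β`, which follows from `q = β p`. The reflection at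
height `n` raises `βⁿ` to `βⁿ⁻¹`, hence the error term. -/
theorem heightOp_pow_le (hβ : 0 < β) (hq : q = β * p) (hpq : p + q = 1) {n j : ℕ}
    (hn : 1 ≤ n) (hβ1 : β < 1) :
    heightOp p q n (fun j => β ^ j) j + (if j = 0 then 1 - β else 0) ≤
      β ^ j + (β⁻¹ - 1) * β ^ n := by
  have hc : 0 ≤ (β⁻¹ - 1) * β ^ n :=
    mul_nonneg (sub_nonneg.2 ((one_le_inv₀ hβ).2 hβ1.le)) (by positivity)
  obtain ⟨m, rfl⟩ : ∃ m, n = m + 1 := ⟨n - 1, by omega⟩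
  unfold heightOp
  rcases j with _ | i
  · simpa using hc
  · simp only [Nat.succ_ne_zero, if_false, add_zero, Nat.add_sub_cancel]
    split_ifs with h
    · obtain rfl : i = m := by omega
      refine le_of_eq ?_
      rw [pow_succ]
      field_simp
      ring
    · have : p * β ^ (i + 1 + 1) + q * β ^ i = β ^ (i + 1) * (p + q) := by rw [hq]; ring
      rw [this, hpq, mul_one]
      linarith

/-- The linear term has drift `-(p - q) βⁿ` inside, but `+βⁿ` at a leaf. The multiple of `1 - βʲ`,
harmonic inside, repairs this: its coefficient is chosen so that it loses `2 p βⁿ` at a leaf, and `1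
- 2p = -(p - q)`. The price is a gain of `2 p β` at the root. -/
theorem heightOp_lyapunov_le (hp : 0 < p) (hβ : 0 < β) (hq : q = β * p) (hpq : p + q = 1)
    {n j : ℕ} (hn : 1 ≤ n) (hβ1 : β < 1) (c : ℝ) :
    heightOp p q n (fun j => β ^ n * (n + c - j) + 2 * p * β / (1 - β) * (1 - β ^ j)) j +
        (p - q) * β ^ n ≤
      β ^ n * (n + c - j) + 2 * p * β / (1 - β) * (1 - β ^ j) +
        (if j = 0 then 2 * p * β else 0) := by
  have h1β : 1 - β ≠ 0 := by linarith
  obtain ⟨A, hA⟩ : ∃ A, A = 2 * p * β / (1 - β) := ⟨_, rfl⟩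
  have hA' : A * (1 - β) = 2 * p * β := by rw [hA]; field_simp
  rw [← hA]
  obtain ⟨m, rfl⟩ : ∃ m, n = m + 1 := ⟨n - 1, by omega⟩
  have hβn : 0 < β ^ (m + 1) := by positivity
  unfold heightOp
  rcases j with _ | i
  · have hq0 : 0 < q := by rw [hq]; positivity
    simp only [if_true, Nat.cast_zero, pow_zero, Nat.cast_one, pow_one]
    nlinarith
  · simp only [Nat.succ_ne_zero, if_false, add_zero, Nat.add_sub_cancel]
    split_ifs with h
    · obtain rfl : i = m := by omega
      refine le_of_eq ?_
      have h2 : A * β ^ i - A * β ^ (i + 1) = 2 * p * β ^ (i + 1) := by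
        linear_combination β ^ i * hA'
      have hq' : q = 1 - p := by linarith
      rw [hq']
      push_cast
      linear_combination -h2
    · refine le_of_eq ?_
      have h2 : p * β ^ (i + 1 + 1) + q * β ^ i = β ^ (i + 1) := by
        have : p * β ^ (i + 1 + 1) + q * β ^ i = β ^ (i + 1) * (p + q) := by rw [hq]; ring
        rw [this, hpq, mul_one]
      push_cast
      linear_combination (-A) * h2 + (β ^ (m + 1) * (m + 1 + c - i - 1) + A) * hpq

theorem heightOp_height_le (hpq : p + q = 1) (h : p ≤ q) {n j : ℕ} (hn : 1 ≤ n) :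
    heightOp p q n (fun j => (j : ℝ)) j ≤ j + (if j = 0 then 1 else 0) := by
  unfold heightOp
  rcases j with _ | i
  · simp
  · simp only [Nat.succ_ne_zero, if_false, add_zero, Nat.add_sub_cancel]
    split_ifs with h'
    · obtain rfl : n = i + 1 := by omega
      simp
    · push_cast
      nlinarith

/-- At inner heights the drift is `4 · 2⁻ʲ (1/2 - 3q/2)`, and `q ≥ 1/2` makes the bracket at most
`-1/4`; this explains the factor `4`. At the root the function rises by `2`, and `w` adds `1`. -/
theorem heightOp_half_pow_le (hpq : p + q = 1) (h : p ≤ q) {n j : ℕ} (hn : 1 ≤ n) :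
    heightOp p q n (fun j => 4 * (1 - (1 / 2 : ℝ) ^ j)) j + (1 / 2 : ℝ) ^ j ≤
      4 * (1 - (1 / 2 : ℝ) ^ j) + (if j = 0 then 3 else 0) := by
  unfold heightOp
  rcases j with _ | i
  · norm_num
  · simp only [Nat.succ_ne_zero, if_false, add_zero, Nat.add_sub_cancel]
    have hi : (0 : ℝ) < (1 / 2) ^ i := by positivity
    split_ifs with h'
    · obtain rfl : n = i + 1 := by omega
      simp only [Nat.add_sub_cancel, pow_succ]
      linarith
    · simp only [pow_succ]
      obtain rfl : p = 1 - q := by linarith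
      nlinarith

end drift

/-! ### Comparison of the return series with the phase series. -/

section walk

variable {k : ℕ} {Ω : Type*} [MeasurableSpace Ω] {μ : Measure Ω} [IsProbabilityMeasure μ]
  {X : ℕ → Ω → List (Fin k)} {hk : 2 ≤ k} {lam : ℝ} {hlam : 0 < lam} {dur : ℕ → ℕ}

/-- Summing a function of the phase along the walk weights each phase by its duration. -/
theorem tsum_ofReal_phase (h : ∀ t, ∃ n, t < (walk k hk lam hlam dur).T n) {c β : ℝ}
    (hc : 0 ≤ c) :
    ∑' t, ENNReal.ofReal (c * β ^ (walk k hk lam hlam dur).phase h t) =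
      ENNReal.ofReal c * ∑' n, ENNReal.ofReal ((dur (n + 1) : ℝ) * β ^ (n + 1)) := by
  simp_rw [ENNReal.ofReal_mul hc]
  rw [ENNReal.tsum_mul_left, RWoGG.tsum_phase _ h (fun n => ENNReal.ofReal (β ^ n))]
  congr 1
  refine tsum_congr fun n => ?_
  rw [ENNReal.ofReal_mul (Nat.cast_nonneg _), ENNReal.ofReal_natCast]
  rfl

theorem tsum_returnProb_lt_top_of_bias_lt (hβ : lam / k < 1)
    (h : ∀ t, ∃ n, t < (walk k hk lam hlam dur).T n)
    (hX : (walk k hk lam hlam dur).IsWalk [] μ X)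
    (hs : ∑' n : ℕ, ENNReal.ofReal ((dur (n + 1) : ℝ) * (lam / k) ^ (n + 1)) ≠ ⊤) :
    ∑' t, returnProb μ X [] t < ⊤ := by
  have hk0 : (0 : ℝ) < k := by exact_mod_cast (by omega : 0 < k)
  have hβ0 : 0 < lam / k := by positivity
  have hc : 0 ≤ (lam / k)⁻¹ - 1 := sub_nonneg.2 ((one_le_inv₀ hβ0).2 hβ.le)
  have key := tsum_heightExp_le h hX (F := fun _ j => (lam / k) ^ j)
    (w := fun _ j => if j = 0 then 1 - lam / k else 0)
    (b := fun n _ => ((lam / k)⁻¹ - 1) * (lam / k) ^ n)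
    (fun _ _ _ => by positivity) (fun _ _ _ _ => le_rfl)
    (fun _ j => by split_ifs <;> linarith) (fun _ _ => by positivity)
    (fun n j hn _ => heightOp_pow_le hβ0 (by field_simp) (by field_simp; ring)
      hn hβ)
  simp only [heightExp_root, heightExp_const hX.measurable] at key
  rw [ENNReal.tsum_mul_right, tsum_ofReal_phase h hc] at key
  have hlt := key.trans_lt
    (ENNReal.add_lt_top.2 ⟨ENNReal.ofReal_lt_top, ENNReal.mul_lt_top ENNReal.ofReal_lt_top hs.lt_top⟩)
  exact ENNReal.lt_top_of_mul_ne_top_left hlt.ne (by simpa using hβ)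

theorem tsum_returnProb_eq_top_of_bias_lt (hβ : lam / k < 1)
    (h : ∀ t, ∃ n, t < (walk k hk lam hlam dur).T n)
    (hX : (walk k hk lam hlam dur).IsWalk [] μ X)
    (hs : ∑' n : ℕ, ENNReal.ofReal ((dur (n + 1) : ℝ) * (lam / k) ^ (n + 1)) = ⊤) :
    ∑' t, returnProb μ X [] t = ⊤ := by
  have hk0 : (0 : ℝ) < k := by exact_mod_cast (by omega : 0 < k)
  obtain ⟨β, hβdef⟩ : ∃ β, β = lam / k := ⟨_, rfl⟩
  obtain ⟨p, hp⟩ : ∃ p, p = k / (lam + k) := ⟨_, rfl⟩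
  obtain ⟨q, hq⟩ : ∃ q, q = lam / (lam + k) := ⟨_, rfl⟩
  have hβ0 : 0 < β := by rw [hβdef]; positivity
  have hp0 : 0 < p := by rw [hp]; positivity
  have hqp : q = β * p := by rw [hp, hq, hβdef]; field_simp
  have hpq : p + q = 1 := by rw [hp, hq]; field_simp; ring
  rw [← hβdef] at hβ hs
  have hlt : 0 < p - q := by rw [hqp]; nlinarith
  have h1β : 0 < 1 - β := by linarith
  -- The shift `c = β/(1-β)` is the fixed point of `c ↦ β (c + 1)`; it makes `βⁿ (n + c - j)`
  -- nonincreasing in `n` for `j ≤ n`.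
  have hc : β * (β / (1 - β) + 1) = β / (1 - β) := by field_simp; ring
  have hc0 : 0 < β / (1 - β) := by positivity
  have key := tsum_heightExp_le h hX
    (F := fun n j => β ^ n * (n + β / (1 - β) - j) + 2 * p * β / (1 - β) * (1 - β ^ j))
    (w := fun n _ => (p - q) * β ^ n) (b := fun _ j => if j = 0 then 2 * p * β else 0)
    (fun n j hj => by
      have h1 : (j : ℝ) ≤ n := by exact_mod_cast hj
      have h2 : β ^ j ≤ 1 := pow_le_one₀ hβ0.le hβ.le
      have h3 : 0 ≤ (n : ℝ) + β / (1 - β) - j := by linarith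
      have h4 : 0 ≤ 1 - β ^ j := by linarith
      positivity)
    (fun n j _ hj => by
      have h1 : (j : ℝ) ≤ n := by exact_mod_cast hj
      have h2 : β * (n - j) ≤ n - j := by nlinarith
      have h3 : β * (n + 1 + β / (1 - β) - j) ≤ n + β / (1 - β) - j := by linarith
      have h4 := mul_le_mul_of_nonneg_left h3 (pow_pos hβ0 n).le
      rw [pow_succ]
      push_cast
      linarith)
    (fun _ _ => by positivity) (fun _ j => by split_ifs <;> positivity)
    (fun n j hn _ => by
      rw [← hp, ← hq]
      exact heightOp_lyapunov_le hp0 hβ0 hqp hpq hn hβ _)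
  simp only [heightExp_root, heightExp_const hX.measurable] at key
  rw [ENNReal.tsum_mul_right, tsum_ofReal_phase h hlt.le, hs,
    ENNReal.mul_top (by simpa using hlt), top_le_iff] at key
  by_contra hR
  exact ENNReal.add_ne_top.2
    ⟨ENNReal.ofReal_ne_top, ENNReal.mul_ne_top hR ENNReal.ofReal_ne_top⟩ key

theorem tsum_returnProb_eq_top_of_le_bias (hβ : 1 ≤ lam / k)
    (h : ∀ t, ∃ n, t < (walk k hk lam hlam dur).T n)
    (hX : (walk k hk lam hlam dur).IsWalk [] μ X) :
    ∑' t, returnProb μ X [] t = ⊤ := by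
  have hk0 : (0 : ℝ) < k := by exact_mod_cast (by omega : 0 < k)
  have hpq : k / (lam + k) + lam / (lam + k) = 1 := by field_simp; ring
  have hle : k / (lam + k) ≤ lam / (lam + k) := by
    gcongr
    exact (one_le_div hk0).1 hβ
  by_contra hR
  obtain ⟨c, hc⟩ := ENNReal.exists_nat_gt hR
  -- As `p ≤ q`, the mean height grows only through visits to the root, by at most one each, so `c`
  -- bounds it.
  have hH : ∀ t, heightExp μ X t (fun j => (j : ℝ)) ≤ c := by
    intro N
    have key := heightExp_add_sum_le h hX (F := fun _ j => (j : ℝ)) (w := fun _ _ => 0)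
      (b := fun _ j => if j = 0 then 1 else 0)
      (fun _ _ _ => by positivity) (fun _ _ _ _ => le_rfl) (fun _ _ => le_rfl)
      (fun _ j => by positivity)
      (fun n j hn _ => by simpa using heightOp_height_le hpq hle hn) N
    simp only [heightExp_root, Nat.cast_zero, ENNReal.ofReal_zero, zero_add, ENNReal.ofReal_one,
      mul_one] at key
    exact le_self_add.trans (key.trans ((ENNReal.sum_le_tsum _).trans hc.le))
  have hpow : ∀ t, 1 ≤ ENNReal.ofReal (2 ^ c) * heightExp μ X t (fun j => (1 / 2 : ℝ) ^ j) := by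
    intro t
    -- A substitute for Jensen: `1 + (c - j) ≤ 2 ^ (c - j)` at every height `j`, integrated against
    -- the law of the height.
    have h1 : heightExp μ X t (fun _ => (1 + c : ℝ)) ≤
        heightExp μ X t (fun j => 2 ^ c * (1 / 2 : ℝ) ^ j + j) := by
      refine heightExp_mono t fun j => ?_
      rcases le_total j c with hj | hj
      · obtain ⟨m, rfl⟩ := Nat.exists_eq_add_of_le hj
        have h2 : (2 : ℝ) ^ (j + m) * (1 / 2) ^ j = 2 ^ m := by
          rw [pow_add, one_div, inv_pow]
          field_simp
        have h3 : (m : ℝ) + 1 ≤ 2 ^ m := by exact_mod_cast Nat.lt_two_pow_self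
        rw [h2]
        push_cast
        linarith
      · rcases hj.eq_or_lt with rfl | hj
        · rw [← mul_pow]
          norm_num
        · have : (c : ℝ) + 1 ≤ j := by exact_mod_cast hj
          have : (0 : ℝ) ≤ 2 ^ c * (1 / 2) ^ j := by positivity
          linarith
    rw [heightExp_const hX.measurable,
      heightExp_add t (fun j => by positivity) (fun j => by positivity),
      heightExp_const_mul t (by positivity), ENNReal.ofReal_add zero_le_one (by positivity),
      ENNReal.ofReal_one, ENNReal.ofReal_natCast] at h1
    exact (ENNReal.add_le_add_iff_right (ENNReal.natCast_ne_top c)).1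
      (h1.trans (by gcongr; exact hH t))
  have key := tsum_heightExp_le h hX (F := fun _ j => 4 * (1 - (1 / 2 : ℝ) ^ j))
    (w := fun _ j => (1 / 2 : ℝ) ^ j) (b := fun _ j => if j = 0 then 3 else 0)
    (fun _ j _ => by
      have : (1 / 2 : ℝ) ^ j ≤ 1 := pow_le_one₀ (by norm_num) (by norm_num)
      linarith)
    (fun _ _ _ _ => le_rfl) (fun _ _ => by positivity) (fun _ j => by positivity)
    (fun n j hn _ => heightOp_half_pow_le hpq hle hn)
  simp only [heightExp_root] at key
  rw [ENNReal.tsum_mul_right] at key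
  have hfin : ∑' t, heightExp μ X t (fun j => (1 / 2 : ℝ) ^ j) ≠ ⊤ :=
    ne_top_of_le_ne_top (ENNReal.add_ne_top.2
      ⟨ENNReal.ofReal_ne_top, ENNReal.mul_ne_top hR ENNReal.ofReal_ne_top⟩) key
  have htop : (⊤ : ℝ≥0∞) ≤
      ENNReal.ofReal (2 ^ c) * ∑' t, heightExp μ X t (fun j => (1 / 2 : ℝ) ^ j) := by
    rw [← ENNReal.tsum_mul_left]
    calc (⊤ : ℝ≥0∞) = ∑' _ : ℕ, 1 := (ENNReal.tsum_const_eq_top_of_ne_zero one_ne_zero).symm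
      _ ≤ _ := ENNReal.tsum_le_tsum hpow
  exact ENNReal.mul_ne_top ENNReal.ofReal_ne_top hfin (top_le_iff.1 htop)

/-- If the edges are biased towards the root at least as much as the tree branches, the phase
series diverges. -/
theorem tsum_dur_mul_pow_eq_top (hβ : 1 ≤ lam / k)
    (h : ∀ t, ∃ n, t < (walk k hk lam hlam dur).T n) :
    ∑' n : ℕ, ENNReal.ofReal ((dur (n + 1) : ℝ) * (lam / k) ^ (n + 1)) = ⊤ := by
  have := tsum_ofReal_phase h (β := lam / k) zero_le_one
  simp only [one_mul, ENNReal.ofReal_one] at this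
  rw [← this, ← top_le_iff]
  calc (⊤ : ℝ≥0∞) = ∑' _ : ℕ, 1 := (ENNReal.tsum_const_eq_top_of_ne_zero one_ne_zero).symm
    _ ≤ _ := ENNReal.tsum_le_tsum fun t => ENNReal.one_le_ofReal.2 (one_le_pow₀ hβ)

end walk

end KaryTree

theorem theorem4p2 (k : ℕ) (hk : 2 ≤ k) (lam : ℝ) (hlam : 0 < lam) (dur : ℕ → ℕ)
    -- the walk runs forever (equivalently, the growing tree has infinitely many vertices)
    (hdur : ∀ N : ℕ, ∃ n, N ≤ n ∧ 0 < dur n)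
    {Ω : Type*} [MeasurableSpace Ω] (μ : Measure Ω) [IsProbabilityMeasure μ]
    (X : ℕ → Ω → List (Fin k)) (hX : (KaryTree.walk k hk lam hlam dur).IsWalk [] μ X) :
    (∑' n : ℕ, ENNReal.ofReal ((dur (n + 1) : ℝ) * (lam / k) ^ (n + 1)) = ⊤ →
        IsRecurrent μ X []) ∧
      (∑' n : ℕ, ENNReal.ofReal ((dur (n + 1) : ℝ) * (lam / k) ^ (n + 1)) ≠ ⊤ →
        IsTransient μ X []) := by
  have h := (KaryTree.walk k hk lam hlam dur).exists_lt_T hdur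
  refine ⟨fun hs => ?_, fun hs => ?_⟩
  · have htop : ∑' t, returnProb μ X [] t = ⊤ := by
      rcases lt_or_ge (lam / k) 1 with hβ | hβ
      · exact KaryTree.tsum_returnProb_eq_top_of_bias_lt hβ h hX hs
      · exact KaryTree.tsum_returnProb_eq_top_of_le_bias hβ h hX
    -- Recurrence sums from `t = 1`; the finite term `R(0)` is split off.
    rw [tsum_eq_zero_add' ENNReal.summable, ENNReal.add_eq_top] at htop
    exact htop.resolve_left (measure_ne_top μ _)
  · refine KaryTree.tsum_returnProb_lt_top_of_bias_lt ?_ h hX hs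
    by_contra! hβ
    exact hs (KaryTree.tsum_dur_mul_pow_eq_top hβ h)
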